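/- Let $\mathcal Y$ be a finite set, $y_0\in\mathcal Y$, and let $\mathcal F$ be a finite (indexed) family of functions $f:\mathcal Y\to\mathcal Y$. Let $s,m'\ge 0$ be integers and $t\ge 0$ a real number with $m'\ge s+t$. Let $\mathcal Y'\subseteq\{0,1\}^s$, let $\Gamma:\mathcal Y\to\mathcal Y'$ be an injection, and let $P:\{0,1\}^s\times\mathcal F\to\{0,1\}^s\cup\{\bot\}$ be any function with $P(\Gamma(y),f)=\Gamma(f(y))$ for all $y\in\mathcal Y$, $f\in\mathcal F$; on inputs outside the image of $\Gamma$, $P$ is arbitrary (it may or may not output $\bot$). For an injection $L:\mathcal Y\to\{0,1\}^{m'}$ let $\mathcal O=\mathcal O_L$ be the oracle on $\{0,1\}^{m'}\times\mathcal F$ with $\mathcal O(L(y),f)=L(f(y))$ and $\mathcal O(\ell,f)=\bot$ if $\ell$ is not in the image of $L$. For an injection $\Pi:\{0,1\}^s\to\{0,1\}^{m'}$ let $\mathcal O'=\mathcal O'_\Pi$ be the oracle with $\mathcal O'(\Pi(z),f)=\Pi(P(z,f))$ (where $\Pi(\bot)=\bot$) and $\mathcal O'(\ell,f)=\bot$ if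 $\ell$ is not in the image of $\Pi$. A quantum query to an oracle $\mathcal Q$ is the unitary $|\ell,f,r\rangle\mapsto|\ell,f,r\oplus\mathcal Q(\ell,f)\rangle$, where answers in $\{0,1\}^{m'}\cup\{\bot\}$ are written on $m'+1$ bits ($\bot$ as the all-zero string, $v$ as $1v$). There is an absolute constant $C>0$ such that for all such data and every quantum algorithm $\mathcal A$ (with finitely many registers and no bound on its computation between queries) which receives a classical input in $\{0,1\}^{m'}$ and makes $q\ge 0$ quantum queries to its oracle, \[\Bigl|\Pr\bigl[\mathcal A^{\mathcal O}(L(y_0))=1\bigr]-\Pr\bigl[\mathcal A^{\mathcal O'}(\Pi(\Gamma(y_0)))=1\bigr]\Bigr|\le C\,q\,2^{-t/2},\] where $L:\mathcal Y\to\{0,1\}^{m'}$ and $\Pi:\{0,1\}^s\to\{0,1\}^{m'}$ are uniformly random injections, and the probabilities are over the choice of $L$, respectively $\Pi$, and the randomness of $\mathcal A$. The algorithm $\mathcal A$ may depend on $y_0,\mathcal Y,\mathcal Y',\Gamma,\mathcal F,P,s,t,m'$. -/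

import Mathlib

open scoped BigOperators

namespace OracleSim

/-- Bit strings of length `n`. -/
abbrev BitString (n : ℕ) : Type := Fin n → Bool

/-- Bitwise exclusive or. -/
def xorString {n : ℕ} (a b : BitString n) : BitString n := fun i => xor (a i) (b i)

/-- Oracle answers are strings in `{0,1}^m` or `⊥` (`none`). They are written on `m + 1` bits:
`⊥` is the all-zero string, and `v` is a bit `1` followed by `v`. -/
def encodeAnswer {m : ℕ} : Option (BitString m) → BitString (m + 1)
  | none => fun _ => false
  | some v => Fin.cons true v

/-- A classical oracle with queries `(ℓ, f)`, where `ℓ ∈ {0,1}^m` and `f` is (the index of) a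
function of the family, and answers in `{0,1}^m ∪ {⊥}`. -/
abbrev Oracle (m : ℕ) (ι : Type*) : Type _ := BitString m → ι → Option (BitString m)

/-- The oracle `O(L(y), f) = L(f(y))`, with `O(ℓ, f) = ⊥` for `ℓ` outside the image of `L`. -/
noncomputable def idealOracle {Y ι : Type*} {m : ℕ} (F : ι → Y → Y) (L : Y ↪ BitString m) :
    Oracle m ι :=
  fun ℓ f => (Function.partialInv L ℓ).map fun y => L (F f y)

/-- The oracle `O'(Π(z), f) = Π(P(z, f))`, with `O'(ℓ, f) = ⊥` for `ℓ` outside the image of `Π`.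
It also answers `⊥` when the procedure `P` itself outputs `⊥`. -/
noncomputable def simulatedOracle {ι : Type*} {s m : ℕ}
    (P : BitString s → ι → Option (BitString s)) (Pi : BitString s ↪ BitString m) :
    Oracle m ι :=
  fun ℓ f => (Function.partialInv Pi ℓ).bind fun z => (P z f).map Pi

/-- Basis labels `(ℓ, f, r, w)` of the registers of a quantum query algorithm: the query `(ℓ, f)`,
the response register `r`, and a work space with basis `W`. -/
abbrev Register (m : ℕ) (ι W : Type*) : Type _ := BitString m × ι × BitString (m + 1) × W

/-- The (finite-dimensional) Hilbert space with orthonormal basis `Register m ι W`. -/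
abbrev StateSpace (m : ℕ) (ι W : Type*) : Type _ := EuclideanSpace ℂ (Register m ι W)

/-- The action of a query on basis labels, `(ℓ, f, r, w) ↦ (ℓ, f, r ⊕ O(ℓ, f), w)`. -/
def queryFun {m : ℕ} {ι : Type*} (W : Type*) (O : Oracle m ι) (b : Register m ι W) :
    Register m ι W :=
  (b.1, b.2.1, xorString b.2.2.1 (encodeAnswer (O b.1 b.2.1)), b.2.2.2)

theorem queryFun_involutive {m : ℕ} {ι : Type*} (W : Type*) (O : Oracle m ι) :
    Function.Involutive (queryFun W O) := by
  rintro ⟨ℓ, f, r, w⟩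
  have h (a : BitString (m + 1)) : xorString (xorString r a) a = r := by
    funext i
    simp [xorString]
  simp [queryFun, h]

/-- A quantum query: the unitary `|ℓ, f, r, w⟩ ↦ |ℓ, f, r ⊕ O(ℓ, f), w⟩`. -/
noncomputable def queryUnitary {m : ℕ} {ι : Type*} [Fintype ι] (W : Type*) [Fintype W]
    (O : Oracle m ι) : StateSpace m ι W ≃ₗᵢ[ℂ] StateSpace m ι W :=
  LinearIsometryEquiv.piLpCongrLeft 2 ℂ ℂ (queryFun_involutive W O).toPerm

/-- A quantum algorithm with a classical input in `{0,1}^m` that makes `q` quantum queries to an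
oracle. It starts in a basis state that depends on the input, and applies a unitary before the
first query and one after each query. Finally all registers are measured in the computational
basis, and the output is `1` when the result lies in `accept`. -/
structure QueryAlgorithm (m : ℕ) (ι W : Type*) [Fintype ι] [Fintype W] (q : ℕ) where
  start : BitString m → Register m ι W
  first : StateSpace m ι W ≃ₗᵢ[ℂ] StateSpace m ι W
  step : Fin q → (StateSpace m ι W ≃ₗᵢ[ℂ] StateSpace m ι W)
  accept : Finset (Register m ι W)

section

variable {m : ℕ} {ι W : Type*} [Fintype ι] [DecidableEq ι] [Fintype W] [DecidableEq W] {q : ℕ}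

/-- The final state of the algorithm on input `x` with oracle `O`. -/
noncomputable def QueryAlgorithm.finalState (A : QueryAlgorithm m ι W q) (O : Oracle m ι)
    (x : BitString m) : StateSpace m ι W :=
  Fin.foldl q (fun ψ i => A.step i (queryUnitary W O ψ))
    (A.first (EuclideanSpace.single (A.start x) (1 : ℂ)))

/-- The probability `Pr[A^O(x) = 1]`. -/
noncomputable def QueryAlgorithm.acceptProb (A : QueryAlgorithm m ι W q) (O : Oracle m ι)
    (x : BitString m) : ℝ :=
  ∑ b ∈ A.accept, ‖A.finalState O x b‖ ^ 2

/-- `Pr[A^O(L(y₀)) = 1]`, for a uniformly random injection `L : Y → {0,1}^m`. -/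
noncomputable def idealProb {Y : Type*} [Fintype Y] [DecidableEq Y] (F : ι → Y → Y) (y₀ : Y)
    (A : QueryAlgorithm m ι W q) : ℝ :=
  𝔼 L : Y ↪ BitString m, A.acceptProb (idealOracle F L) (L y₀)

/-- `Pr[A^{O'}(Π(z₀)) = 1]`, for a uniformly random injection `Π : {0,1}^s → {0,1}^m`. -/
noncomputable def simulatedProb {s : ℕ} (P : BitString s → ι → Option (BitString s))
    (z₀ : BitString s) (A : QueryAlgorithm m ι W q) : ℝ :=
  𝔼 Pi : BitString s ↪ BitString m, A.acceptProb (simulatedOracle P Pi) (Pi z₀)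

end

end OracleSim

namespace OracleSim

/-! ### Cost of changing the oracle in one query, and of measuring nearby states -/

section Query

variable {m : ℕ} {ι W : Type*} [Fintype ι] [Fintype W]

/-! Couple the two experiments by `L = Π ∘ Γ`, which is again a uniform injection
(`expect_restrict`). The inputs then coincide, and the oracles differ only on the bad strings `Π(x)`
with `x` outside the image of `Γ`. A hybrid argument replaces the oracle query by query. The state
before each replaced query comes from the ideal run, so it depends on `L` alone; given `L`, each bad
string is uniform on the complement of the image of `L`. Hence the expected query mass on bad
strings is at most `2^s / 2^m'` (`expect_mass_le`), which is at most `2^(-t)`, and Jensen turns this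
into an expected amplitude of at most `2^(-t/2)` per query. -/

theorem queryUnitary_apply (O : Oracle m ι) (ψ : StateSpace m ι W) (b : Register m ι W) :
    queryUnitary W O ψ b = ψ (queryFun W O b) := by
  simp only [queryUnitary, LinearIsometryEquiv.piLpCongrLeft_apply]
  rfl

open Classical in
/-- The component of a state on the basis labels whose query string lies in `S`. -/
noncomputable def restrictQuery (S : Set (BitString m)) (ψ : StateSpace m ι W) :
    StateSpace m ι W :=
  WithLp.toLp 2 fun b => if b.1 ∈ S then ψ b else 0

/-- A query preserves the query string, so the part of the state off `S` cancels; the triangle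
inequality on the rest gives the factor 2. -/
theorem norm_queryUnitary_sub_le {O O' : Oracle m ι} {S : Set (BitString m)}
    (h : ∀ ℓ ∉ S, O ℓ = O' ℓ) (ψ : StateSpace m ι W) :
    ‖queryUnitary W O ψ - queryUnitary W O' ψ‖ ≤ 2 * ‖restrictQuery S ψ‖ := by
  have key : queryUnitary W O ψ - queryUnitary W O' ψ
      = queryUnitary W O (restrictQuery S ψ) - queryUnitary W O' (restrictQuery S ψ) := by
    ext b
    simp only [PiLp.sub_apply, queryUnitary_apply, restrictQuery, queryFun]
    by_cases hb : b.1 ∈ S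
    · simp [hb]
    · simp [hb, h _ hb]
  rw [key]
  refine (norm_sub_le _ _).trans ?_
  simp only [LinearIsometryEquiv.norm_map]
  linarith

theorem norm_sq_restrictQuery (S : Set (BitString m)) [DecidablePred (· ∈ S)]
    (ψ : StateSpace m ι W) :
    ‖restrictQuery S ψ‖ ^ 2
      = ∑ ℓ : BitString m, if ℓ ∈ S then ∑ c, ‖ψ (ℓ, c)‖ ^ 2 else 0 := by
  rw [EuclideanSpace.norm_sq_eq, Fintype.sum_prod_type]
  refine Finset.sum_congr rfl fun ℓ _ => ?_
  by_cases hℓ : ℓ ∈ S <;> simp [restrictQuery, hℓ]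

/-- Factor the difference of squares of the norms of the projections to `T`: their sum is at most 2,
and projecting does not increase distance. -/
theorem abs_sum_norm_sq_sub_le {B : Type*} [Fintype B] (T : Finset B)
    (φ ψ : EuclideanSpace ℂ B) (hφ : ‖φ‖ = 1) (hψ : ‖ψ‖ = 1) :
    |∑ b ∈ T, ‖φ b‖ ^ 2 - ∑ b ∈ T, ‖ψ b‖ ^ 2| ≤ 2 * ‖φ - ψ‖ := by
  classical
  let R : EuclideanSpace ℂ B → EuclideanSpace ℂ B := fun χ =>
    WithLp.toLp 2 fun b => if b ∈ T then χ b else 0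
  have hR (χ : EuclideanSpace ℂ B) : ∑ b ∈ T, ‖χ b‖ ^ 2 = ‖R χ‖ ^ 2 := by
    rw [EuclideanSpace.norm_sq_eq, ← Finset.sum_filter_add_sum_filter_not Finset.univ (· ∈ T)]
    rw [Finset.sum_eq_zero (s := Finset.univ.filter (· ∉ T)) fun b hb => by simp_all [R], add_zero]
    simp only [Finset.filter_univ_mem]
    exact Finset.sum_congr rfl fun b hb => by simp [R, hb]
  have hle (χ : EuclideanSpace ℂ B) : ‖R χ‖ ≤ ‖χ‖ := by
    refine le_of_sq_le_sq ?_ (norm_nonneg _)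
    rw [← hR, EuclideanSpace.norm_sq_eq]
    exact Finset.sum_le_sum_of_subset_of_nonneg (Finset.subset_univ _) fun _ _ _ => by positivity
  have hsub : R φ - R ψ = R (φ - ψ) := by
    ext b
    by_cases hb : b ∈ T <;> simp [R, hb]
  have hd : |‖R φ‖ - ‖R ψ‖| ≤ ‖φ - ψ‖ :=
    (abs_norm_sub_norm_le _ _).trans (hsub ▸ hle _)
  have h2 : ‖R φ‖ + ‖R ψ‖ ≤ 2 := by linarith [hle φ, hle ψ]
  rw [hR, hR, sq_sub_sq, abs_mul, abs_of_nonneg (by positivity)]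
  exact mul_le_mul h2 hd (abs_nonneg _) (by norm_num)

end Query

/-! ### Random injections and their restrictions -/

section Injections

variable {X Y Z : Type*} [Fintype X] [Fintype Y] [Fintype Z] [DecidableEq Z]

/-- Any two injections into a finite type differ by a permutation of the target. -/
theorem exists_perm_trans_eq (L L' : Y ↪ Z) :
    ∃ σ : Equiv.Perm Z, L.trans σ.toEmbedding = L' := by
  classical
  let e : {z // z ∈ Set.range L} ≃ {z // z ∈ Set.range L'} :=
    (Equiv.ofInjective L L.injective).symm.trans (Equiv.ofInjective L' L'.injective)
  refine ⟨e.extendSubtype, ?_⟩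
  ext y
  have := e.extendSubtype_apply_of_mem (L y) ⟨y, rfl⟩
  have hy : (Equiv.ofInjective L L.injective).symm ⟨L y, ⟨y, rfl⟩⟩ = y :=
    Equiv.ofInjective_symm_apply L.injective y
  simp [this, e, hy]

/-- The restriction of a uniformly random injection is a uniformly random injection. -/
theorem expect_restrict [DecidableEq Y] (Γ : Y ↪ X) [Nonempty (X ↪ Z)] (f : (Y ↪ Z) → ℝ) :
    𝔼 P : X ↪ Z, f (Γ.trans P) = 𝔼 L : Y ↪ Z, f L := by
  obtain ⟨P₀⟩ := ‹Nonempty (X ↪ Z)›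
  let N : (Y ↪ Z) → ℕ := fun L => (Finset.univ.filter fun P : X ↪ Z => Γ.trans P = L).card
  -- All fibres of restriction have equal size, since permutations of `Z` carry one onto another.
  have hN (L : Y ↪ Z) : N L = N (Γ.trans P₀) := by
    obtain ⟨σ, rfl⟩ := exists_perm_trans_eq (Γ.trans P₀) L
    refine Finset.card_bij' (fun P _ => P.trans σ.symm.toEmbedding)
      (fun P _ => P.trans σ.toEmbedding) ?_ ?_ ?_ ?_
    · intro P hP
      simp only [Finset.mem_filter, Finset.mem_univ, true_and] at hP ⊢
      ext y
      have := DFunLike.congr_fun hP y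
      simp only [Function.Embedding.trans_apply, Equiv.coe_toEmbedding] at this
      simp [this]
    · intro P hP
      simp only [Finset.mem_filter, Finset.mem_univ, true_and] at hP ⊢
      ext y
      have := DFunLike.congr_fun hP y
      simp only [Function.Embedding.trans_apply] at this
      simp [this]
    · intro P _; ext x; simp
    · intro P _; ext x; simp
  have hsum (g : (Y ↪ Z) → ℝ) :
      ∑ P : X ↪ Z, g (Γ.trans P) = N (Γ.trans P₀) * ∑ L, g L := by
    rw [← Finset.sum_fiberwise Finset.univ fun P : X ↪ Z => Γ.trans P, Finset.mul_sum]
    refine Finset.sum_congr rfl fun L _ => ?_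
    rw [Finset.sum_congr rfl (g := fun _ => g L) fun P hP => by
      rw [(Finset.mem_filter.1 hP).2], Finset.sum_const, nsmul_eq_mul, ← hN L]
  have hcard := hsum fun _ => 1
  simp only [Finset.sum_const, nsmul_eq_mul, mul_one] at hcard
  have hpos : (0 : ℝ) < (Finset.univ : Finset (X ↪ Z)).card := by
    exact_mod_cast Finset.card_pos.2 ⟨P₀, Finset.mem_univ _⟩
  have hN0 : (N (Γ.trans P₀) : ℝ) ≠ 0 := by
    intro h
    rw [h, zero_mul] at hcard
    exact hpos.ne' hcard
  rw [Finset.expect_eq_sum_div_card, Finset.expect_eq_sum_div_card, hsum, hcard,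
    mul_div_mul_left _ _ hN0]

/-- Conditioned on the restriction of a random injection to the range of `Γ`, its value at a point
`x` outside this range is uniform on the unused elements. -/
theorem sum_apply_mul_card (Γ : Y ↪ X) {x : X} (hx : x ∉ Set.range Γ) (g : (Y ↪ Z) → Z → ℝ) :
    ∑ P : X ↪ Z, ((Fintype.card Z : ℝ) - Fintype.card Y) * g (Γ.trans P) (P x)
      = ∑ P : X ↪ Z, ∑ z ∈ Finset.univ.filter (· ∉ Set.range (Γ.trans P)), g (Γ.trans P) z := by
  have hc (P : X ↪ Z) : ((Fintype.card Z : ℝ) - Fintype.card Y) * g (Γ.trans P) (P x)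
      = ∑ _z ∈ Finset.univ.filter (· ∉ Set.range (Γ.trans P)), g (Γ.trans P) (P x) := by
    rw [Finset.sum_const, nsmul_eq_mul]
    congr 1
    have h := Finset.card_filter_add_card_filter_not (s := (Finset.univ : Finset Z))
      (· ∈ Set.range (Γ.trans P))
    have h' : (Finset.univ.filter (· ∈ Set.range (Γ.trans P))).card = Fintype.card Y := by
      rw [← Finset.card_univ, ← Finset.card_map (Γ.trans P)]
      congr 1
      ext z
      simp
    rw [h', Finset.card_univ] at h
    rw [← h]
    push_cast
    ring
  have hfix (P : X ↪ Z) (z : Z) (hz : z ∉ Set.range (Γ.trans P)) :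
      Γ.trans (P.trans (Equiv.swap (P x) z).toEmbedding) = Γ.trans P := by
    ext y
    simp only [Function.Embedding.trans_apply, Equiv.coe_toEmbedding]
    refine Equiv.swap_apply_of_ne_of_ne (fun h => hx ⟨y, P.injective h⟩) fun h => hz ⟨y, h⟩
  rw [Finset.sum_congr rfl fun P _ => hc P, Finset.sum_sigma', Finset.sum_sigma']
  -- Swapping the value `P x` with an unused `z` is an involution on pairs `(P, z)` that fixes the
  -- restriction to `Γ`.
  refine Finset.sum_bij'
    (fun a _ => ⟨a.1.trans (Equiv.swap (a.1 x) a.2).toEmbedding, a.1 x⟩)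
    (fun a _ => ⟨a.1.trans (Equiv.swap (a.1 x) a.2).toEmbedding, a.1 x⟩) ?_ ?_ ?_ ?_ ?_
  iterate 2
    rintro ⟨P, z⟩ h
    simp only [Finset.mem_sigma, Finset.mem_univ, Finset.mem_filter, true_and] at h ⊢
    rw [hfix P z h]
    rintro ⟨y, hy⟩
    exact hx ⟨y, P.injective hy⟩
  iterate 2
    rintro ⟨P, z⟩ h
    simp only [Function.Embedding.trans_apply, Equiv.coe_toEmbedding, Equiv.swap_apply_left]
    congr 1
    ext w
    simp [Equiv.swap_comm z (P x)]
  rintro ⟨P, z⟩ h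
  simp only [Finset.mem_sigma, Finset.mem_univ, Finset.mem_filter, true_and] at h
  simp only
  rw [hfix P z h]

/-- A subprobability vector that depends only on the restriction of a random injection `P` to the
range of `Γ` gives the image under `P` of the complement of this range mass at most `|X| / |Z|`
on average. -/
theorem expect_mass_le [DecidableEq X] (Γ : Y ↪ X) [Nonempty X] [Nonempty (X ↪ Z)] (g : (Y ↪ Z) → Z → ℝ)
    (h0 : ∀ L z, 0 ≤ g L z) (h1 : ∀ L, ∑ z, g L z ≤ 1) :
    𝔼 P : X ↪ Z, ∑ x ∈ Finset.univ.filter (· ∉ Set.range Γ), g (Γ.trans P) (P x)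
      ≤ (Fintype.card X : ℝ) / Fintype.card Z := by
  obtain ⟨P₀⟩ := ‹Nonempty (X ↪ Z)›
  have hXZ : (Fintype.card X : ℝ) ≤ Fintype.card Z := by
    exact_mod_cast Fintype.card_le_of_embedding P₀
  have hX : (0 : ℝ) < Fintype.card X := by exact_mod_cast Fintype.card_pos
  have hpos : (0 : ℝ) < (Finset.univ : Finset (X ↪ Z)).card := by
    exact_mod_cast Finset.card_pos.2 ⟨P₀, Finset.mem_univ _⟩
  have hpt (x : X) (hx : x ∉ Set.range Γ) : ((Fintype.card Z : ℝ) - Fintype.card Y) *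
      ∑ P : X ↪ Z, g (Γ.trans P) (P x) ≤ (Finset.univ : Finset (X ↪ Z)).card := by
    rw [Finset.mul_sum, sum_apply_mul_card Γ hx g, Finset.card_eq_sum_ones, Nat.cast_sum]
    refine Finset.sum_le_sum fun P _ => ?_
    rw [Nat.cast_one]
    exact (Finset.sum_le_sum_of_subset_of_nonneg (Finset.filter_subset _ _)
      fun z _ _ => h0 _ z).trans (h1 _)
  have hk : ((Finset.univ.filter (· ∉ Set.range Γ)).card : ℝ)
      = Fintype.card X - Fintype.card Y := by
    have h := Finset.card_filter_add_card_filter_not (s := (Finset.univ : Finset X))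
      (· ∈ Set.range Γ)
    have h' : (Finset.univ.filter (· ∈ Set.range Γ)).card = Fintype.card Y := by
      rw [← Finset.card_univ, ← Finset.card_map Γ]
      congr 1
      ext z
      simp
    rw [h', Finset.card_univ] at h
    rw [← h]
    push_cast
    ring
  rw [Finset.expect_eq_sum_div_card, Finset.sum_comm, div_le_div_iff₀ hpos (by linarith)]
  -- If `Γ` is onto there is no mass to bound; otherwise `|Y| < |X| ≤ |Z|`, so dividing by `|Z| -
  -- |Y|` is legitimate.
  rcases (Finset.univ.filter (· ∉ Set.range Γ)).eq_empty_or_nonempty with he | ⟨x₀, hx₀⟩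
  · rw [he]
    simp only [Finset.sum_empty, zero_mul]
    positivity
  · have hYX : (Fintype.card Y : ℝ) < Fintype.card X := by
      rw [← sub_pos, ← hk]
      exact_mod_cast Finset.card_pos.2 ⟨x₀, hx₀⟩
    have hsum := Finset.sum_le_sum (s := Finset.univ.filter (· ∉ Set.range Γ))
      fun x hx => hpt x (Finset.mem_filter.1 hx).2
    rw [← Finset.mul_sum, Finset.sum_const, nsmul_eq_mul, hk] at hsum
    set T := ∑ x ∈ Finset.univ.filter (· ∉ Set.range Γ), ∑ P : X ↪ Z, g (Γ.trans P) (P x)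
    set N := ((Finset.univ : Finset (X ↪ Z)).card : ℝ)
    have hY : (0 : ℝ) ≤ Fintype.card Y := by positivity
    have hd : (0 : ℝ) < (Fintype.card Z : ℝ) - Fintype.card Y := by linarith
    refine le_of_mul_le_mul_left ?_ hd
    calc _ = ((Fintype.card Z - Fintype.card Y) * T) * (Fintype.card Z : ℝ) := by ring
      _ ≤ ((Fintype.card X - Fintype.card Y) * N) * (Fintype.card Z : ℝ) := by gcongr
      _ = N * ((Fintype.card X - Fintype.card Y) * Fintype.card Z) := by ring
      _ ≤ N * ((Fintype.card Z - Fintype.card Y) * Fintype.card X) := by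
          gcongr N * ?_
          -- After expansion this is `|Y| |X| ≤ |Y| |Z|`.
          nlinarith
      _ = _ := by ring

end Injections

theorem idealOracle_eq_simulatedOracle {m s : ℕ} {Y ι : Type*} {F : ι → Y → Y}
    {P : BitString s → ι → Option (BitString s)} {Γ : Y ↪ BitString s}
    (hP : ∀ y f, P (Γ y) f = some (Γ (F f y))) (Q : BitString s ↪ BitString m)
    {ℓ : BitString m} (hℓ : ℓ ∉ Q '' (Set.range Γ)ᶜ) :
    idealOracle F (Γ.trans Q) ℓ = simulatedOracle P Q ℓ := by
  funext f
  by_cases h : ∃ z, Q z = ℓ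
  · obtain ⟨z, rfl⟩ := h
    have hz : z ∈ Set.range Γ := by
      by_contra hz
      exact hℓ ⟨z, hz, rfl⟩
    obtain ⟨y, rfl⟩ := hz
    have h1 : Function.partialInv (Γ.trans Q) (Q (Γ y)) = some y :=
      Function.partialInv_left (Γ.trans Q).injective y
    have h2 : Function.partialInv Q (Q (Γ y)) = some (Γ y) :=
      Function.partialInv_left Q.injective _
    simp [idealOracle, simulatedOracle, h1, h2, hP]
  · have h1 : Function.partialInv (Γ.trans Q) ℓ = none :=
      dif_neg fun ⟨y, hy⟩ => h ⟨Γ y, hy⟩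
    have h2 : Function.partialInv Q ℓ = none := dif_neg h
    simp [idealOracle, simulatedOracle, h1, h2]

/-! ### The hybrid argument -/

section Hybrid

variable {m s : ℕ} {Y ι W : Type*} [Fintype Y] [Fintype ι] [Fintype W]

/-- A query state that depends only on `Γ.trans Q` detects the difference between the ideal and the
simulated oracle only with small amplitude, on average over `Q`. -/
theorem expect_norm_query_sub_le {F : ι → Y → Y} {P : BitString s → ι → Option (BitString s)}
    {Γ : Y ↪ BitString s} (hP : ∀ y f, P (Γ y) f = some (Γ (F f y)))
    [Nonempty (BitString s ↪ BitString m)]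
    (ψ : (Y ↪ BitString m) → StateSpace m ι W) (hψ : ∀ L, ‖ψ L‖ = 1) :
    𝔼 Q : BitString s ↪ BitString m,
      ‖queryUnitary W (idealOracle F (Γ.trans Q)) (ψ (Γ.trans Q))
        - queryUnitary W (simulatedOracle P Q) (ψ (Γ.trans Q))‖
      ≤ 2 * √((2 : ℝ) ^ s / 2 ^ m) := by
  classical
  let a : (BitString s ↪ BitString m) → ℝ := fun Q =>
    ‖restrictQuery (Q '' (Set.range Γ)ᶜ) (ψ (Γ.trans Q))‖
  have hmass : 𝔼 Q, a Q ^ 2 ≤ (2 : ℝ) ^ s / 2 ^ m := by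
    have h := expect_mass_le (Z := BitString m) Γ (fun L ℓ => ∑ c, ‖ψ L (ℓ, c)‖ ^ 2)
      (fun _ _ => by positivity) (fun L => by
        rw [← Fintype.sum_prod_type (f := fun b => ‖ψ L b‖ ^ 2), ← EuclideanSpace.norm_sq_eq, hψ]
        norm_num)
    simp only [Fintype.card_pi, Fintype.card_bool, Finset.prod_const, Finset.card_univ,
      Fintype.card_fin, Nat.cast_pow, Nat.cast_ofNat] at h
    refine le_of_eq_of_le (Finset.expect_congr rfl fun Q _ => ?_) h
    simp only [a]
    rw [norm_sq_restrictQuery, ← Finset.sum_filter,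
      ← Finset.sum_map (Finset.univ.filter (· ∉ Set.range Γ)) Q
        fun ℓ => ∑ c, ‖ψ (Γ.trans Q) (ℓ, c)‖ ^ 2]
    refine Finset.sum_congr ?_ fun _ _ => rfl
    ext ℓ
    simp
  have hjensen : (𝔼 Q, a Q) ^ 2 ≤ 𝔼 Q, a Q ^ 2 := by
    rw [Finset.expect_eq_sum_div_card, Finset.expect_eq_sum_div_card]
    exact sum_div_card_sq_le_sum_sq_div_card
  have ha : 𝔼 Q, a Q ≤ √((2 : ℝ) ^ s / 2 ^ m) := Real.le_sqrt_of_sq_le (hjensen.trans hmass)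
  calc _ ≤ 𝔼 Q, 2 * a Q := Finset.expect_le_expect fun Q _ =>
        norm_queryUnitary_sub_le (fun ℓ hℓ => idealOracle_eq_simulatedOracle hP Q hℓ) _
    _ = 2 * 𝔼 Q, a Q := (Finset.mul_expect _ _ _).symm
    _ ≤ _ := by gcongr

/-- The state after the queries of an algorithm with the unitaries `step`, started in `ψ`. -/
noncomputable def runState {q : ℕ} (step : Fin q → (StateSpace m ι W ≃ₗᵢ[ℂ] StateSpace m ι W))
    (O : Oracle m ι) (ψ : StateSpace m ι W) : StateSpace m ι W :=
  Fin.foldl q (fun ψ i => step i (queryUnitary W O ψ)) ψ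

theorem runState_succ {q : ℕ}
    (step : Fin (q + 1) → (StateSpace m ι W ≃ₗᵢ[ℂ] StateSpace m ι W))
    (O : Oracle m ι) (ψ : StateSpace m ι W) :
    runState step O ψ = step (Fin.last q)
      (queryUnitary W O (runState (fun i => step i.castSucc) O ψ)) :=
  Fin.foldl_succ_last _ _

theorem norm_runState {q : ℕ} (step : Fin q → (StateSpace m ι W ≃ₗᵢ[ℂ] StateSpace m ι W))
    (O : Oracle m ι) (ψ : StateSpace m ι W) : ‖runState step O ψ‖ = ‖ψ‖ := by
  induction q with
  | zero => simp [runState]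
  | succ q ih => rw [runState_succ, LinearIsometryEquiv.norm_map, LinearIsometryEquiv.norm_map, ih]

theorem expect_norm_runState_sub_le {F : ι → Y → Y}
    {P : BitString s → ι → Option (BitString s)}
    {Γ : Y ↪ BitString s} (hP : ∀ y f, P (Γ y) f = some (Γ (F f y)))
    [Nonempty (BitString s ↪ BitString m)] {q : ℕ}
    (step : Fin q → (StateSpace m ι W ≃ₗᵢ[ℂ] StateSpace m ι W))
    (ψ : (Y ↪ BitString m) → StateSpace m ι W) (hψ : ∀ L, ‖ψ L‖ = 1) :
    𝔼 Q : BitString s ↪ BitString m,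
      ‖runState step (idealOracle F (Γ.trans Q)) (ψ (Γ.trans Q))
        - runState step (simulatedOracle P Q) (ψ (Γ.trans Q))‖
      ≤ q * (2 * √((2 : ℝ) ^ s / 2 ^ m)) := by
  induction q with
  | zero => simp [runState]
  | succ q ih =>
    -- The last query is compared on the ideal run, whose state is a function of `L` only; the
    -- simulated run would depend on all of `Q`.
    have hq := expect_norm_query_sub_le hP
      (fun L => runState (fun i => step i.castSucc) (idealOracle F L) (ψ L))
      fun L => by rw [norm_runState, hψ]
    have hi := ih fun i => step i.castSucc
    push_cast
    rw [add_mul, one_mul]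
    refine le_trans ?_ (add_le_add hi hq)
    rw [← Finset.expect_add_distrib]
    refine Finset.expect_le_expect fun Q _ => ?_
    rw [runState_succ, runState_succ, ← map_sub, LinearIsometryEquiv.norm_map]
    -- The hybrid makes its earlier queries to the ideal oracle and its last to the simulated one.
    refine (norm_sub_le_norm_sub_add_norm_sub _ (queryUnitary W (simulatedOracle P Q)
      (runState (fun i => step i.castSucc) (idealOracle F (Γ.trans Q)) (ψ (Γ.trans Q)))) _).trans ?_
    rw [← map_sub (queryUnitary W (simulatedOracle P Q)), LinearIsometryEquiv.norm_map, add_comm]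

end Hybrid

theorem abs_idealProb_sub_simulatedProb_le {m s q : ℕ} {Y ι W : Type*} [Fintype Y]
    [DecidableEq Y] [Fintype ι] [DecidableEq ι] [Fintype W] [DecidableEq W] {F : ι → Y → Y}
    {P : BitString s → ι → Option (BitString s)} {Γ : Y ↪ BitString s}
    (hP : ∀ y f, P (Γ y) f = some (Γ (F f y))) (hsm : s ≤ m) (y₀ : Y)
    (A : QueryAlgorithm m ι W q) :
    |idealProb F y₀ A - simulatedProb P (Γ y₀) A| ≤ 4 * (q * √((2 : ℝ) ^ s / 2 ^ m)) := by
  have : Nonempty (BitString s ↪ BitString m) :=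
    Function.Embedding.nonempty_of_card_le (by simpa using Nat.pow_le_pow_right two_pos hsm)
  let ψ : (Y ↪ BitString m) → StateSpace m ι W := fun L =>
    A.first (EuclideanSpace.single (A.start (L y₀)) (1 : ℂ))
  have hψ (L) : ‖ψ L‖ = 1 := by simp [ψ]
  rw [idealProb, simulatedProb, ← expect_restrict Γ, ← Finset.expect_sub_distrib]
  calc _ ≤ 𝔼 Q : BitString s ↪ BitString m,
        |A.acceptProb (idealOracle F (Γ.trans Q)) (Γ.trans Q y₀)
          - A.acceptProb (simulatedOracle P Q) (Q (Γ y₀))| := Finset.abs_expect_le _ _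
    _ ≤ 𝔼 Q : BitString s ↪ BitString m,
        2 * ‖runState A.step (idealOracle F (Γ.trans Q)) (ψ (Γ.trans Q))
          - runState A.step (simulatedOracle P Q) (ψ (Γ.trans Q))‖ :=
      Finset.expect_le_expect fun Q _ => abs_sum_norm_sq_sub_le A.accept _ _
        ((norm_runState A.step _ _).trans (hψ (Γ.trans Q)))
        ((norm_runState A.step _ _).trans (hψ (Γ.trans Q)))
    _ = 2 * 𝔼 Q : BitString s ↪ BitString m,
        ‖runState A.step (idealOracle F (Γ.trans Q)) (ψ (Γ.trans Q))
          - runState A.step (simulatedOracle P Q) (ψ (Γ.trans Q))‖ :=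
      (Finset.mul_expect _ _ _).symm
    _ ≤ 2 * (q * (2 * √((2 : ℝ) ^ s / 2 ^ m))) := by
      gcongr
      exact expect_norm_runState_sub_le hP A.step ψ hψ
    _ = _ := by ring

end OracleSim

theorem mainTheorem11 :
    ∃ C : ℝ, 0 < C ∧
      ∀ {Y ι W : Type*} [Fintype Y] [DecidableEq Y] [Fintype ι] [DecidableEq ι]
        [Fintype W] [DecidableEq W]
        (F : ι → Y → Y) (y₀ : Y) (s m' : ℕ) (t : ℝ)
        (Y' : Set (OracleSim.BitString s)) (Γ : Y → Y')
        (P : OracleSim.BitString s → ι → Option (OracleSim.BitString s)) (q : ℕ)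
        (A : OracleSim.QueryAlgorithm m' ι W q),
        Function.Injective Γ →
        (∀ (y : Y) (f : ι), P (Γ y) f = some (Γ (F f y) : OracleSim.BitString s)) →
        0 ≤ t → (s : ℝ) + t ≤ (m' : ℝ) →
        |OracleSim.idealProb F y₀ A
            - OracleSim.simulatedProb P (Γ y₀ : OracleSim.BitString s) A|
          ≤ C * ((q : ℝ) * (2 : ℝ) ^ (-t / 2)) := by
  -- One factor 2 comes from each query, another from passing from states to probabilities.
  refine ⟨4, by norm_num, ?_⟩
  intro Y ι W _ _ _ _ _ _ F y₀ s m' t Y' Γ P q A hΓ hP ht hst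
  have hsm : s ≤ m' := by
    have : (s : ℝ) ≤ m' := by linarith
    exact_mod_cast this
  let Γ' : Y ↪ OracleSim.BitString s := ⟨fun y => Γ y, Subtype.val_injective.comp hΓ⟩
  refine (OracleSim.abs_idealProb_sub_simulatedProb_le (Γ := Γ') hP hsm y₀ A).trans ?_
  gcongr
  rw [Real.sqrt_eq_rpow, ← Real.rpow_natCast, ← Real.rpow_natCast, ← Real.rpow_sub two_pos,
    ← Real.rpow_mul two_pos.le]
  exact Real.rpow_le_rpow_of_exponent_le one_le_two (by linarith)
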